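/- For every integer $n\ge 2$ there is a group $G$ having a presentation with finitely many generators and finitely many relators, all lying in the commutator subgroup of the free group on the generators (a finitely presented commutator-relators group), such that: the first Betti number $b_1(G)=\dim_{\mathbb C}H_1(G,\mathbb C)$ equals $n$; the kernel of the cup-product map $\cup_G\colon H^1(G,\mathbb C)\wedge H^1(G,\mathbb C)\to H^2(G,\mathbb C)$ has codimension exactly $2n-3$ in $H^1(G,\mathbb C)\wedge H^1(G,\mathbb C)$; and $\mathcal R(G)=\{0\}$, where $$\mathcal R(G)=\{a\in H^1(G,\mathbb C)\mid \exists\, b\in H^1(G,\mathbb C):\ a\wedge b\neq 0,\ a\wedge b\in\ker(\cup_G)\}\cup\{0\}$$ is the resonance variety of $G$. -/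

import Mathlib

open scoped ExteriorAlgebra

/-- A finitely presented commutator-relators group: `G` has a presentation with finitely many
generators and finitely many relators, all of which are products of commutators, i.e. lie in the
commutator subgroup of the free group on the generators. -/
def IsFinitelyPresentedCommutatorRelators (G : Type*) [Group G] : Prop :=
  ∃ (d : ℕ) (rels : Set (FreeGroup (Fin d))), rels.Finite ∧
    rels ⊆ (commutator (FreeGroup (Fin d)) : Set (FreeGroup (Fin d))) ∧
    Nonempty (G ≃* PresentedGroup rels)

namespace ComplexGroupCohomology

/-- The trivial `G`-representation on `ℂ`. -/
abbrev coeff (G : Type) [Group G] : Rep ℂ G := Rep.trivial ℂ G ℂ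

/-- `H¹(G, ℂ)`. -/
abbrev H1 (G : Type) [Group G] : Type := groupCohomology.H1 (coeff G)

/-- `H²(G, ℂ)`. -/
abbrev H2 (G : Type) [Group G] : Type := groupCohomology.H2 (coeff G)

/-- The homomorphism `G → ℂ` (the unique `1`-cocycle) representing a class in `H¹(G, ℂ)`. -/
noncomputable def toHom (G : Type) [Group G] : H1 G ≃ₗ[ℂ] (Additive G →+ ℂ) :=
  (groupCohomology.H1IsoOfIsTrivial (coeff G)).toLinearEquiv

/-- The first Betti number `b₁(G) = dim H₁(G, ℂ)`. -/
noncomputable def b₁ (G : Type) [Group G] : ℕ :=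
  Module.finrank ℂ (groupHomology.H1 (coeff G))

variable {G : Type} [Group G]

/-- The cup product of two `1`-cocycles, `(f ∪ g)(x, y) = f(x) g(y)`, as a `2`-cocycle. -/
noncomputable def cupCocycle (f g : Additive G →+ ℂ) : groupCohomology.cocycles₂ (coeff G) :=
  ⟨fun p => f (Additive.ofMul p.1) * g (Additive.ofMul p.2), by
    rw [groupCohomology.mem_cocycles₂_iff]
    intro x y z
    simp only [ofMul_mul, map_add]
    change _ = f (Additive.ofMul y) * g (Additive.ofMul z) + _
    ring⟩

/-- The cup product of two classes in `H¹(G, ℂ)`. -/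
noncomputable def cup (a b : H1 G) : H2 G :=
  (groupCohomology.H2π (coeff G)).hom (cupCocycle (toHom G a) (toHom G b))

theorem cup_add_left (a a' b : H1 G) : cup (a + a') b = cup a b + cup a' b := by
  unfold cup
  rw [← map_add]
  congr 1
  refine Subtype.ext (funext fun p => ?_)
  change _ = ((_ : ℂ) + (_ : ℂ))
  simp [cupCocycle, add_mul]

theorem cup_add_right (a b b' : H1 G) : cup a (b + b') = cup a b + cup a b' := by
  unfold cup
  rw [← map_add]
  congr 1
  refine Subtype.ext (funext fun p => ?_)
  change _ = ((_ : ℂ) + (_ : ℂ))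
  simp [cupCocycle, mul_add]

theorem cup_smul_left (c : ℂ) (a b : H1 G) : cup (c • a) b = c • cup a b := by
  unfold cup
  rw [← map_smul]
  congr 1
  refine Subtype.ext (funext fun p => ?_)
  change _ = c * _
  simp [cupCocycle, mul_assoc]

theorem cup_smul_right (c : ℂ) (a b : H1 G) : cup a (c • b) = c • cup a b := by
  unfold cup
  rw [← map_smul]
  congr 1
  refine Subtype.ext (funext fun p => ?_)
  change _ = c * _
  simp [cupCocycle, mul_left_comm]

theorem cup_self (a : H1 G) : cup a a = 0 := by
  unfold cup
  refine (groupCohomology.H2π_eq_zero_iff _).2 ?_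
  refine ⟨fun x => -(toHom G a (Additive.ofMul x)) ^ 2 / 2, ?_⟩
  funext p
  change _ = toHom G a (Additive.ofMul p.1) * toHom G a (Additive.ofMul p.2)
  simp [groupCohomology.d₁₂_hom_apply]
  ring

/-- The cup product as an alternating bilinear map on `H¹(G, ℂ)`. -/
noncomputable def cupAlternating (G : Type) [Group G] : H1 G [⋀^Fin 2]→ₗ[ℂ] H2 G where
  toFun v := cup (v 0) (v 1)
  map_update_add' v i x y := by
    fin_cases i <;> simp [Function.update, cup_add_left, cup_add_right]
  map_update_smul' v i c x := by
    fin_cases i <;> simp [Function.update, cup_smul_left, cup_smul_right]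
  map_eq_zero_of_eq' v i j h hij := by
    have h01 : v 0 = v 1 := by
      fin_cases i <;> fin_cases j <;> simp_all
    simp only [h01, cup_self]

/-- The cup-product map `∪_G : H¹(G, ℂ) ∧ H¹(G, ℂ) → H²(G, ℂ)`. -/
noncomputable def cupProductMap (G : Type) [Group G] : ⋀[ℂ]^2 (H1 G) →ₗ[ℂ] H2 G :=
  exteriorPower.alternatingMapLinearEquiv (cupAlternating G)

end ComplexGroupCohomology

/-- The codimension of a linear subspace (used here only in finite-dimensional spaces). -/
noncomputable def Submodule.complexCodim {E : Type*} [AddCommGroup E] [Module ℂ E]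
    (L : Submodule ℂ E) : ℕ :=
  Module.finrank ℂ (E ⧸ L)

/-- The resonance variety of a subspace `Kperp ⊆ W ∧ W` (with `W = V*`, `Kperp = K^⊥`):
all `a ∈ W` for which there is `b ∈ W` with `0 ≠ a ∧ b ∈ Kperp`, together with `0`. -/
def resonanceVariety {W : Type*} [AddCommGroup W] [Module ℂ W]
    (Kperp : Submodule ℂ (⋀[ℂ]^2 W)) : Set W :=
  {a | ∃ b : W, exteriorPower.ιMulti ℂ 2 ![a, b] ≠ 0 ∧
    exteriorPower.ιMulti ℂ 2 ![a, b] ∈ Kperp} ∪ {0}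

/-- The resonance variety `R(G) ⊆ H¹(G, ℂ)` of a group, with `K^⊥ = ker ∪_G`. -/
def groupResonanceVariety (G : Type) [Group G] : Set (ComplexGroupCohomology.H1 G) :=
  resonanceVariety (LinearMap.ker (ComplexGroupCohomology.cupProductMap G))

/-! Take generators `x_0, …, x_{n-1}` and, for each sum `s = 1, …, 2n - 3`, the relator `∏ [x_i,
x_j]` over `i < j`, `i + j = s`. The relators are products of commutators, so `H¹ = ℂⁿ`. A bilinear
cocycle is a coboundary iff its antisymmetrisation sums to zero along every relator
(`exists_coboundary_iff`), so `ker ∪_G` is cut out by `2n - 3` functionals with disjoint nonempty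
supports, which gives the codimension. If `a ∧ b ≠ 0`, subtracting a multiple of `a` from `b` makes
their leading indices `i ≠ j` distinct. The functional of sum `i + j` then sees only the product of
the leading coefficients, up to sign, so `a ∧ b` is not in the kernel. -/

open scoped commutatorElement

/-! ### Functions whose coboundary is a bilinear form -/

/-- The central extension of `G` by `ℂ` with cocycle a biadditive form `B` on `G`. -/
@[ext]
structure BilinearExtension {G : Type*} [Group G] (B : Additive G →+ Additive G →+ ℂ) where
  /-- The component in `G`. -/
  base : G
  /-- The central component. -/
  fiber : ℂ

namespace BilinearExtension

variable {G : Type*} [Group G] {B : Additive G →+ Additive G →+ ℂ}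

instance : Mul (BilinearExtension B) :=
  ⟨fun x y => ⟨x.base * y.base,
    x.fiber + y.fiber + B (Additive.ofMul x.base) (Additive.ofMul y.base)⟩⟩

instance : One (BilinearExtension B) := ⟨⟨1, 0⟩⟩

instance : Inv (BilinearExtension B) :=
  ⟨fun x => ⟨x.base⁻¹, -x.fiber + B (Additive.ofMul x.base) (Additive.ofMul x.base)⟩⟩

@[simp] theorem mul_base (x y : BilinearExtension B) : (x * y).base = x.base * y.base := rfl

@[simp] theorem mul_fiber (x y : BilinearExtension B) : (x * y).fiber =
    x.fiber + y.fiber + B (Additive.ofMul x.base) (Additive.ofMul y.base) := rfl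

@[simp] theorem one_base : (1 : BilinearExtension B).base = 1 := rfl

@[simp] theorem one_fiber : (1 : BilinearExtension B).fiber = 0 := rfl

@[simp] theorem inv_base (x : BilinearExtension B) : x⁻¹.base = x.base⁻¹ := rfl

@[simp] theorem inv_fiber (x : BilinearExtension B) :
    x⁻¹.fiber = -x.fiber + B (Additive.ofMul x.base) (Additive.ofMul x.base) := rfl

instance : Group (BilinearExtension B) :=
  Group.ofLeftAxioms
    (fun x y z => by
      ext
      · simp [mul_assoc]
      · simp only [mul_fiber, mul_base, ofMul_mul, map_add, AddMonoidHom.add_apply]; ring)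
    (fun x => by ext <;> simp)
    (fun x => by ext <;> simp)

/-- The projection of the extension onto `G`. -/
def proj (B : Additive G →+ Additive G →+ ℂ) : BilinearExtension B →* G where
  toFun := base
  map_one' := rfl
  map_mul' _ _ := rfl

end BilinearExtension

section Coboundary

variable {H : Type*} [Group H] {B : Additive H →+ Additive H →+ ℂ} {h : H → ℂ}

theorem coboundary_apply_one
    (hh : ∀ x y, h (x * y) = h x + h y + B (Additive.ofMul x) (Additive.ofMul y)) : h 1 = 0 := by
  simpa using hh 1 1

/-- Compare `h` on both sides of `xy = [x, y] yx`: the mixed term vanishes because `B`, having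
abelian target, kills commutators. -/
theorem coboundary_apply_commutator
    (hh : ∀ x y, h (x * y) = h x + h y + B (Additive.ofMul x) (Additive.ofMul y)) (x y : H) :
    h ⁅x, y⁆ = B (Additive.ofMul x) (Additive.ofMul y) -
      B (Additive.ofMul y) (Additive.ofMul x) := by
  have h1 : x * y = ⁅x, y⁆ * (y * x) := by simp [commutatorElement_def, mul_assoc]
  have h3 : B (Additive.ofMul ⁅x, y⁆) = 0 := by
    simp only [commutatorElement_def, ofMul_mul, ofMul_inv, map_add, map_neg]; abel
  have h4 := hh ⁅x, y⁆ (y * x)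
  rw [← h1, hh x y, hh y x, h3] at h4
  simp only [AddMonoidHom.zero_apply] at h4
  linear_combination -h4

theorem coboundary_apply_prod_commutator {ι : Type*}
    (hh : ∀ x y, h (x * y) = h x + h y + B (Additive.ofMul x) (Additive.ofMul y))
    (u v : ι → H) (l : List ι) :
    h (l.map fun i => ⁅u i, v i⁆).prod =
      (l.map fun i => B (Additive.ofMul (u i)) (Additive.ofMul (v i)) -
        B (Additive.ofMul (v i)) (Additive.ofMul (u i))).sum := by
  induction l with
  | nil => simpa using coboundary_apply_one hh
  | cons i l ih =>
    have h3 : B (Additive.ofMul ⁅u i, v i⁆) = 0 := by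
      simp only [commutatorElement_def, ofMul_mul, ofMul_inv, map_add, map_neg]; abel
    simp [hh, ih, coboundary_apply_commutator hh, h3]

end Coboundary

/-! ### The group -/

/-- The pairs `i < j` with `i + j = k + 1`. -/
def pairsOfSum (n k : ℕ) : Finset (Fin n × Fin n) :=
  Finset.univ.filter fun p => p.1 < p.2 ∧ (p.1 : ℕ) + p.2 = k + 1

theorem mem_pairsOfSum {n k : ℕ} {p : Fin n × Fin n} :
    p ∈ pairsOfSum n k ↔ p.1 < p.2 ∧ (p.1 : ℕ) + p.2 = k + 1 := by
  simp [pairsOfSum]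

/-- The product of the commutators `[x_i, x_j]` over all `i < j` with `i + j = k + 1`. -/
noncomputable def antidiagonalRelator (n k : ℕ) : FreeGroup (Fin n) :=
  ((pairsOfSum n k).toList.map fun p => ⁅FreeGroup.of p.1, FreeGroup.of p.2⁆).prod

/-- The antidiagonal relators with indices `0, …, 2n - 4`. -/
def antidiagonalRelators (n : ℕ) : Set (FreeGroup (Fin n)) :=
  Set.range fun k : Fin (2 * n - 3) => antidiagonalRelator n k

theorem antidiagonalRelator_mem_commutator (n k : ℕ) :
    antidiagonalRelator n k ∈ commutator (FreeGroup (Fin n)) := by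
  refine Subgroup.list_prod_mem _ fun x hx => ?_
  obtain ⟨p, -, rfl⟩ := List.mem_map.1 hx
  exact Subgroup.commutator_mem_commutator (Subgroup.mem_top _) (Subgroup.mem_top _)

/-- The group generated by `n` elements subject to the antidiagonal relators. -/
abbrev AntidiagonalGroup (n : ℕ) : Type := PresentedGroup (antidiagonalRelators n)

namespace AntidiagonalGroup

variable {n : ℕ}

/-- The `i`-th generator, written additively. -/
def gen (i : Fin n) : Additive (AntidiagonalGroup n) := Additive.ofMul (PresentedGroup.of i)

theorem isFinitelyPresentedCommutatorRelators (n : ℕ) :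
    IsFinitelyPresentedCommutatorRelators (AntidiagonalGroup n) := by
  refine ⟨n, antidiagonalRelators n, Set.finite_range _, ?_, ⟨MulEquiv.refl _⟩⟩
  rintro _ ⟨k, rfl⟩
  exact antidiagonalRelator_mem_commutator n k

theorem addMonoidHom_ext {f g : Additive (AntidiagonalGroup n) →+ ℂ}
    (h : ∀ i, f (gen i) = g (gen i)) : f = g := by
  apply AddMonoidHom.toMultiplicativeRight.injective
  refine PresentedGroup.ext fun i => ?_
  exact congrArg Multiplicative.ofAdd (h i)

theorem exists_addMonoidHom (v : Fin n → ℂ) :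
    ∃ f : Additive (AntidiagonalGroup n) →+ ℂ, ∀ i, f (gen i) = v i := by
  have hv : ∀ r ∈ antidiagonalRelators n,
      FreeGroup.lift (fun i => Multiplicative.ofAdd (v i)) r = 1 := by
    rintro _ ⟨k, rfl⟩
    exact Abelianization.commutator_subset_ker _ (antidiagonalRelator_mem_commutator n k)
  refine ⟨AddMonoidHom.toMultiplicativeRight.symm (PresentedGroup.toGroup hv), fun i => ?_⟩
  exact congrArg Multiplicative.toAdd (PresentedGroup.toGroup.of hv)

/-- A primitive `h` amounts to a homomorphic section `x ↦ (x, h x)` of the central extension. Such a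
section exists once the lifts of the relators, which are central, are trivial; their fibers are the
displayed sums. -/
theorem exists_coboundary_iff
    (B : Additive (AntidiagonalGroup n) →+ Additive (AntidiagonalGroup n) →+ ℂ) :
    (∃ h : AntidiagonalGroup n → ℂ, ∀ x y,
      h (x * y) = h x + h y + B (Additive.ofMul x) (Additive.ofMul y)) ↔
    ∀ k : Fin (2 * n - 3), ∑ p ∈ pairsOfSum n k,
      (B (gen p.1) (gen p.2) - B (gen p.2) (gen p.1)) = 0 := by
  constructor
  · rintro ⟨h, hh⟩ k
    have h1 : PresentedGroup.mk (antidiagonalRelators n) (antidiagonalRelator n k) = 1 :=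
      PresentedGroup.one_of_mem ⟨k, rfl⟩
    have h2 := coboundary_apply_prod_commutator hh
      (fun p : Fin n × Fin n => PresentedGroup.of p.1) (fun p => PresentedGroup.of p.2)
      (pairsOfSum n k).toList
    rw [Finset.sum_map_toList] at h2
    refine h2.symm.trans ?_
    rw [← coboundary_apply_one hh, ← h1, antidiagonalRelator, map_list_prod, List.map_map]
    rfl
  · intro hB
    let σ : FreeGroup (Fin n) →* BilinearExtension B :=
      FreeGroup.lift fun i => ⟨PresentedGroup.of i, 0⟩
    have hbase : ∀ w, (σ w).base = PresentedGroup.mk _ w := by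
      have : (BilinearExtension.proj B).comp σ = PresentedGroup.mk (antidiagonalRelators n) := by
        refine FreeGroup.ext_hom _ _ fun i => ?_
        simp [σ, BilinearExtension.proj, PresentedGroup.of]
      exact fun w => DFunLike.congr_fun this w
    -- Pulling `B` back to the free group makes the fiber of `σ` a primitive there, so the
    -- commutator formula computes it on relators.
    let m : Additive (FreeGroup (Fin n)) →+ Additive (AntidiagonalGroup n) :=
      MonoidHom.toAdditive (PresentedGroup.mk _)
    have hfiber : ∀ x y, (σ (x * y)).fiber = (σ x).fiber + (σ y).fiber +
        ((B.comp m).compl₂ m) (Additive.ofMul x) (Additive.ofMul y) := by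
      intro x y
      rw [map_mul, BilinearExtension.mul_fiber, hbase, hbase]
      rfl
    have hrel : ∀ r ∈ antidiagonalRelators n,
        FreeGroup.lift (fun i => (⟨PresentedGroup.of i, 0⟩ : BilinearExtension B)) r = 1 := by
      rintro _ ⟨k, rfl⟩
      refine BilinearExtension.ext ((hbase _).trans (PresentedGroup.one_of_mem ⟨k, rfl⟩)) ?_
      refine (coboundary_apply_prod_commutator (h := fun w => (σ w).fiber) hfiber
        (fun p : Fin n × Fin n => FreeGroup.of p.1)
        (fun p => FreeGroup.of p.2) (pairsOfSum n k).toList).trans ?_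
      rw [Finset.sum_map_toList]
      exact hB k
    let s := PresentedGroup.toGroup hrel
    have hs : ∀ x, (s x).base = x := by
      have : (BilinearExtension.proj B).comp s = MonoidHom.id _ :=
        PresentedGroup.ext fun i => by
          simp [s, BilinearExtension.proj, PresentedGroup.toGroup.of]
      exact fun x => DFunLike.congr_fun this x
    refine ⟨fun x => (s x).fiber, fun x y => ?_⟩
    simp only [map_mul, BilinearExtension.mul_fiber, hs]

end AntidiagonalGroup

/-! ### The kernel of the cup product -/

namespace ComplexGroupCohomology

theorem H2π_eq_zero_iff_exists_coboundary {G : Type} [Group G]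
    (c : groupCohomology.cocycles₂ (coeff G)) (B : Additive G →+ Additive G →+ ℂ)
    (hc : ∀ x y, c (x, y) = B (Additive.ofMul x) (Additive.ofMul y)) :
    (groupCohomology.H2π (coeff G)).hom c = 0 ↔ ∃ h : G → ℂ, ∀ x y,
      h (x * y) = h x + h y + B (Additive.ofMul x) (Additive.ofMul y) := by
  refine (groupCohomology.H2π_eq_zero_iff _).trans ?_
  constructor
  · rintro ⟨u, hu⟩
    refine ⟨fun x => -u x, fun x y => ?_⟩
    have := (congrFun hu (x, y)).trans (hc x y)
    rw [← this, groupCohomology.d₁₂_hom_apply]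
    change -u (x * y) = -u x + -u y + (u y - u (x * y) + u x)
    ring
  · rintro ⟨h, hh⟩
    refine ⟨fun x => -h x, funext fun p => ?_⟩
    refine Eq.trans ?_ (hc p.1 p.2).symm
    rw [groupCohomology.d₁₂_hom_apply]
    change -h p.2 - -h (p.1 * p.2) + -h p.1 = _
    rw [hh]
    ring

variable {n : ℕ}

/-- The coordinates of a class in `H¹`. -/
noncomputable def coord (n : ℕ) : H1 (AntidiagonalGroup n) ≃ₗ[ℂ] (Fin n → ℂ) :=
  LinearEquiv.ofBijective
    { toFun := fun a i => toHom _ a (AntidiagonalGroup.gen i)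
      map_add' := fun a b => by ext i; simp
      map_smul' := fun c a => by ext i; simp }
    ⟨fun a b h => (toHom _).injective
        (AntidiagonalGroup.addMonoidHom_ext fun i => congrFun h i), fun v => by
      obtain ⟨f, hf⟩ := AntidiagonalGroup.exists_addMonoidHom v
      exact ⟨(toHom _).symm f, funext fun i => by simp [hf]⟩⟩

theorem coord_apply (a : H1 (AntidiagonalGroup n)) (i : Fin n) :
    coord n a i = toHom _ a (AntidiagonalGroup.gen i) := rfl

/-- The alternating form `(a, b) ↦ ∑ (a_i b_j - a_j b_i)`, over `i < j` with `i + j = k + 1`. -/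
noncomputable def antidiagonalAlternating (n : ℕ) :
    H1 (AntidiagonalGroup n) [⋀^Fin 2]→ₗ[ℂ] (Fin (2 * n - 3) → ℂ) where
  toFun v k := ∑ p ∈ pairsOfSum n k,
    (coord n (v 0) p.1 * coord n (v 1) p.2 - coord n (v 0) p.2 * coord n (v 1) p.1)
  map_update_add' v i x y := by
    ext k
    rw [Pi.add_apply, ← Finset.sum_add_distrib]
    refine Finset.sum_congr rfl fun p _ => ?_
    fin_cases i <;> simp [Function.update] <;> ring
  map_update_smul' v i c x := by
    ext k
    rw [Pi.smul_apply, Finset.smul_sum]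
    refine Finset.sum_congr rfl fun p _ => ?_
    fin_cases i <;> simp [Function.update] <;> ring
  map_eq_zero_of_eq' v i j h hij := by
    have h01 : v 0 = v 1 := by
      fin_cases i <;> fin_cases j <;> simp_all
    ext k
    refine Finset.sum_eq_zero fun p _ => ?_
    rw [h01]
    ring

/-- The linear map on `H¹ ∧ H¹` evaluating a class on the relators. -/
noncomputable def antidiagonalMap (n : ℕ) :
    ⋀[ℂ]^2 (H1 (AntidiagonalGroup n)) →ₗ[ℂ] (Fin (2 * n - 3) → ℂ) :=
  exteriorPower.alternatingMapLinearEquiv (antidiagonalAlternating n)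

theorem antidiagonalMap_ιMulti (a b : H1 (AntidiagonalGroup n)) (k : Fin (2 * n - 3)) :
    antidiagonalMap n (exteriorPower.ιMulti ℂ 2 ![a, b]) k = ∑ p ∈ pairsOfSum n k,
      (coord n a p.1 * coord n b p.2 - coord n a p.2 * coord n b p.1) := by
  rw [antidiagonalMap, exteriorPower.alternatingMapLinearEquiv_apply_ιMulti]
  rfl

/-- Elements of the kernel need not be decomposable, so one form `B` must represent all of `ω`; it
is built by linearity from decomposables. -/
theorem exists_bilinear_cocycle (ω : ⋀[ℂ]^2 (H1 (AntidiagonalGroup n))) :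
    ∃ (c : groupCohomology.cocycles₂ (coeff (AntidiagonalGroup n)))
      (B : Additive (AntidiagonalGroup n) →+ Additive (AntidiagonalGroup n) →+ ℂ),
      cupProductMap _ ω = (groupCohomology.H2π (coeff (AntidiagonalGroup n))).hom c ∧
      (∀ x y, c (x, y) = B (Additive.ofMul x) (Additive.ofMul y)) ∧
      ∀ k, antidiagonalMap n ω k = ∑ p ∈ pairsOfSum n k,
        (B (AntidiagonalGroup.gen p.1) (AntidiagonalGroup.gen p.2) -
          B (AntidiagonalGroup.gen p.2) (AntidiagonalGroup.gen p.1)) := by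
  have hω : ω ∈ Submodule.span ℂ (Set.range (exteriorPower.ιMulti ℂ 2)) := by
    rw [exteriorPower.ιMulti_span]; trivial
  induction hω using Submodule.span_induction with
  | mem ω hω =>
    obtain ⟨v, rfl⟩ := hω
    refine ⟨cupCocycle (toHom _ (v 0)) (toHom _ (v 1)),
      (AddMonoidHom.mul.comp (toHom _ (v 0))).compl₂ (toHom _ (v 1)), ?_, fun x y => rfl,
      fun k => ?_⟩
    · rw [cupProductMap, exteriorPower.alternatingMapLinearEquiv_apply_ιMulti]
      rfl
    · rw [antidiagonalMap, exteriorPower.alternatingMapLinearEquiv_apply_ιMulti]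
      rfl
  | zero => exact ⟨0, 0, by simp, fun x y => rfl, fun k => by simp⟩
  | add ω η _ _ h1 h2 =>
    obtain ⟨c, B, hc, hB, hk⟩ := h1
    obtain ⟨c', B', hc', hB', hk'⟩ := h2
    refine ⟨c + c', B + B', by rw [map_add, map_add, hc, hc'], fun x y => ?_, fun k => ?_⟩
    · exact congrArg₂ (· + ·) (hB x y) (hB' x y)
    · rw [map_add, Pi.add_apply, hk, hk', ← Finset.sum_add_distrib]
      refine Finset.sum_congr rfl fun p _ => ?_
      simp only [AddMonoidHom.add_apply]
      ring
  | smul t ω _ h1 =>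
    obtain ⟨c, B, hc, hB, hk⟩ := h1
    refine ⟨t • c, B.compr₂ (AddMonoidHom.mulLeft t), by rw [map_smul, map_smul, hc],
      fun x y => ?_, fun k => ?_⟩
    · exact congrArg (t * ·) (hB x y)
    · rw [map_smul, Pi.smul_apply, hk, Finset.smul_sum]
      refine Finset.sum_congr rfl fun p _ => ?_
      exact mul_sub t _ _

theorem ker_cupProductMap (n : ℕ) : LinearMap.ker (cupProductMap (AntidiagonalGroup n)) =
    LinearMap.ker (antidiagonalMap n) := by
  ext ω
  obtain ⟨c, B, hc, hB, hk⟩ := exists_bilinear_cocycle ω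
  rw [LinearMap.mem_ker, LinearMap.mem_ker, hc, H2π_eq_zero_iff_exists_coboundary c B hB,
    AntidiagonalGroup.exists_coboundary_iff, funext_iff]
  simp only [hk, Pi.zero_apply]

/-! ### Codimension of the kernel -/

theorem antidiagonalMap_surjective (n : ℕ) : Function.Surjective (antidiagonalMap n) := by
  rw [← LinearMap.range_eq_top, eq_top_iff, ← (Pi.basisFun ℂ (Fin (2 * n - 3))).span_eq,
    Submodule.span_le]
  rintro _ ⟨k, rfl⟩
  obtain ⟨i, j, hij, hk⟩ : ∃ i j : Fin n, i < j ∧ (i : ℕ) + j = k + 1 := by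
    have := k.2
    -- Use `(0, k + 1)` if it fits, otherwise `(k + 2 - n, n - 1)`.
    by_cases h : (k : ℕ) + 1 < n
    · exact ⟨⟨0, by omega⟩, ⟨k + 1, h⟩, by simp [Fin.lt_def], by simp⟩
    · exact ⟨⟨k + 1 - (n - 1), by omega⟩, ⟨n - 1, by omega⟩, by simp [Fin.lt_def]; omega,
        by simp; omega⟩
  refine ⟨exteriorPower.ιMulti ℂ 2 ![(coord n).symm (Pi.single i 1),
    (coord n).symm (Pi.single j 1)], funext fun l => ?_⟩
  rw [antidiagonalMap_ιMulti]
  simp only [LinearEquiv.apply_symm_apply, Pi.basisFun_apply]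
  have hterm : ∀ p ∈ pairsOfSum n l, (Pi.single i 1 : Fin n → ℂ) p.1 *
      (Pi.single j 1 : Fin n → ℂ) p.2 - (Pi.single i 1 : Fin n → ℂ) p.2 *
      (Pi.single j 1 : Fin n → ℂ) p.1 = if p = (i, j) then 1 else 0 := by
    rintro ⟨p, q⟩ hp
    have hpq : p < q := (mem_pairsOfSum.1 hp).1
    have h0 : ¬ (q = i ∧ p = j) := by rintro ⟨rfl, rfl⟩; exact lt_asymm hij hpq
    simp only [Pi.single_apply, Prod.mk.injEq]
    split_ifs <;> simp_all
  rw [Finset.sum_congr rfl hterm, Finset.sum_ite_eq', Pi.single_apply]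
  refine if_congr ?_ rfl rfl
  rw [mem_pairsOfSum]
  simp only [hij, true_and, hk, Fin.ext_iff]
  omega

theorem complexCodim_ker_cupProductMap (n : ℕ) :
    (LinearMap.ker (cupProductMap (AntidiagonalGroup n))).complexCodim = 2 * n - 3 := by
  rw [ker_cupProductMap, Submodule.complexCodim,
    ((antidiagonalMap n).quotKerEquivOfSurjective (antidiagonalMap_surjective n)).finrank_eq]
  simp

/-! ### Triviality of the resonance variety -/

theorem antidiagonalMap_ne_zero_of_lt {a b : H1 (AntidiagonalGroup n)} {i j : Fin n} (hij : i < j)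
    (ha : coord n a i ≠ 0) (ha' : ∀ l < i, coord n a l = 0)
    (hb : coord n b j ≠ 0) (hb' : ∀ l < j, coord n b l = 0) :
    antidiagonalMap n (exteriorPower.ιMulti ℂ 2 ![a, b]) ≠ 0 := by
  intro h
  have hi := i.2
  have hj := j.2
  have hlt : (i : ℕ) < j := hij
  have hk := congrFun h ⟨i + j - 1, by omega⟩
  rw [antidiagonalMap_ιMulti, Finset.sum_eq_single (i, j)] at hk
  · simp only [hb' i hij, mul_zero, sub_zero, Pi.zero_apply] at hk
    exact mul_ne_zero ha hb hk
  · rintro ⟨p, q⟩ hp hne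
    rw [mem_pairsOfSum] at hp
    obtain ⟨hpq, hs⟩ := hp
    simp only [Fin.lt_def] at hpq hs
    -- `2p < p + q = i + j < 2j`, so `p < j`.
    have h1 : coord n b p = 0 := hb' p (by rw [Fin.lt_def]; omega)
    have h2 : coord n a p * coord n b q = 0 := by
      rcases lt_trichotomy (p : ℕ) i with hpi | hpi | hpi
      · rw [ha' p hpi, zero_mul]
      · exact absurd (Prod.ext (Fin.ext hpi) (Fin.ext (by simp only; omega))) hne
      · rw [hb' q (by rw [Fin.lt_def]; omega), mul_zero]
    simp only [h1, h2, mul_zero, sub_zero]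
  · intro hn
    exact absurd (mem_pairsOfSum.2 ⟨hij, by simp only; omega⟩) hn

theorem ιMulti_swap {W : Type*} [AddCommGroup W] [Module ℂ W] (a b : W) :
    exteriorPower.ιMulti ℂ 2 ![b, a] = -exteriorPower.ιMulti ℂ 2 ![a, b] := by
  rw [← AlternatingMap.map_swap _ _ (show (0 : Fin 2) ≠ 1 by decide)]
  congr 1
  ext i
  fin_cases i <;> rfl

theorem ιMulti_sub_smul {W : Type*} [AddCommGroup W] [Module ℂ W] (a b : W) (t : ℂ) :
    exteriorPower.ιMulti ℂ 2 ![a, b - t • a] = exteriorPower.ιMulti ℂ 2 ![a, b] := by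
  have h1 := (exteriorPower.ιMulti ℂ 2).map_update_sub ![a, b] 1 b (t • a)
  have h2 := (exteriorPower.ιMulti ℂ 2).map_update_smul ![a, b] 1 t a
  have h3 := (exteriorPower.ιMulti ℂ 2).map_eq_zero_of_eq ![a, a] (i := 0) (j := 1) rfl (by decide)
  have hu : ∀ x : W, Function.update ![a, b] 1 x = ![a, x] := fun x => by
    ext i; fin_cases i <;> rfl
  simp only [hu] at h1 h2
  rw [h1, h2, h3, smul_zero, sub_zero]

theorem exists_leading_coord {a : H1 (AntidiagonalGroup n)} (ha : a ≠ 0) :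
    ∃ i, coord n a i ≠ 0 ∧ ∀ l < i, coord n a l = 0 := by
  have h : ∃ i, coord n a i ≠ 0 := by
    by_contra! h
    exact ha ((coord n).map_eq_zero_iff.1 (funext h))
  obtain ⟨i, hi⟩ := WellFounded.has_min (wellFounded_lt (α := Fin n)) {i | coord n a i ≠ 0} h
  exact ⟨i, hi.1, fun l hl => by_contra fun hne => hi.2 l hne hl⟩

theorem ιMulti_eq_zero_of_antidiagonalMap {a b : H1 (AntidiagonalGroup n)}
    (h : antidiagonalMap n (exteriorPower.ιMulti ℂ 2 ![a, b]) = 0) :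
    exteriorPower.ιMulti ℂ 2 ![a, b] = 0 := by
  by_contra hne
  have ha : a ≠ 0 := by
    rintro rfl
    exact hne ((exteriorPower.ιMulti ℂ 2).map_coord_zero 0 rfl)
  obtain ⟨i, hi, hi'⟩ := exists_leading_coord ha
  -- Clearing coordinate `i` of `b` prevents its leading index from being `i`.
  set b' := b - (coord n b i / coord n a i) • a with hb'
  have hab : exteriorPower.ιMulti ℂ 2 ![a, b'] = exteriorPower.ιMulti ℂ 2 ![a, b] :=
    ιMulti_sub_smul a b _
  have hbi : coord n b' i = 0 := by simp [hb', hi]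
  rw [← hab] at h hne
  have hb0 : b' ≠ 0 := by
    intro h0
    exact hne ((exteriorPower.ιMulti ℂ 2).map_coord_zero 1 h0)
  obtain ⟨j, hj, hj'⟩ := exists_leading_coord hb0
  rcases lt_trichotomy i j with hij | rfl | hij
  · exact antidiagonalMap_ne_zero_of_lt hij hi hi' hj hj' h
  · exact hj hbi
  · refine antidiagonalMap_ne_zero_of_lt hij hj hj' hi hi' ?_
    rw [ιMulti_swap, map_neg, h, neg_zero]

theorem groupResonanceVariety_antidiagonalGroup (n : ℕ) :
    groupResonanceVariety (AntidiagonalGroup n) = {0} := by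
  rw [groupResonanceVariety, resonanceVariety, ker_cupProductMap, Set.union_eq_right]
  rintro a ⟨b, hne, hb⟩
  exact absurd (ιMulti_eq_zero_of_antidiagonalMap hb) hne

/-! ### The first Betti number, via the duality of `H₁` with `Hom(G, ℂ)` -/

/-- The class in `H₁(G, ℂ)` of an element of `ℂ[G]`, viewed as a `1`-cycle. -/
noncomputable def homologyClass (G : Type) [Group G] :
    (G →₀ ℂ) →ₗ[ℂ] groupHomology.H1 (coeff G) :=
  (groupHomology.H1π (coeff G)).hom ∘ₗ (groupHomology.cycles₁IsoOfIsTrivial (coeff G)).inv.hom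

theorem homologyClass_surjective (G : Type) [Group G] :
    Function.Surjective (homologyClass G) := fun x => by
  induction x using groupHomology.H1_induction_on with
  | h x => exact ⟨x.1, rfl⟩

theorem homologyClass_eq_zero_iff {G : Type} [Group G] (x : G →₀ ℂ) :
    homologyClass G x = 0 ↔ x ∈ groupHomology.boundaries₁ (coeff G) :=
  groupHomology.H1π_eq_zero_iff (A := coeff G) _

theorem d₂₁_single_coeff {G : Type} [Group G] (g h : G) (t : ℂ) :
    groupHomology.d₂₁ (coeff G) (Finsupp.single (g, h) t) =
      (Finsupp.single h t - Finsupp.single (g * h) t + Finsupp.single g t : G →₀ ℂ) :=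
  groupHomology.d₂₁_single (A := coeff G) (g, h) t

theorem homologyClass_single_mul {G : Type} [Group G] (g h : G) :
    homologyClass G (Finsupp.single (g * h) 1) =
      homologyClass G (Finsupp.single g 1) + homologyClass G (Finsupp.single h 1) := by
  have h0 : homologyClass G
      (Finsupp.single h 1 - Finsupp.single (g * h) 1 + Finsupp.single g 1) = 0 :=
    (homologyClass_eq_zero_iff _).2 ⟨Finsupp.single (g, h) 1, d₂₁_single_coeff g h 1⟩
  rw [map_add, map_sub] at h0
  rw [← sub_eq_zero, ← neg_eq_zero, ← h0]
  abel

/-- The homomorphism `G → ℂ` defined by a functional on `H₁(G, ℂ)`. -/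
noncomputable def dualHom {G : Type} [Group G]
    (ψ : Module.Dual ℂ (groupHomology.H1 (coeff G))) : Additive G →+ ℂ :=
  AddMonoidHom.mk' (fun g => ψ (homologyClass G (Finsupp.single g.toMul 1))) fun g h => by
    rw [toMul_add, homologyClass_single_mul, map_add]

theorem dualHom_injective (G : Type) [Group G] : Function.Injective (dualHom (G := G)) := by
  intro ψ χ h
  refine LinearMap.ext fun x => ?_
  obtain ⟨y, rfl⟩ := homologyClass_surjective G x
  have : ψ ∘ₗ homologyClass G = χ ∘ₗ homologyClass G := by
    ext g
    exact DFunLike.congr_fun h (Additive.ofMul g)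
  exact LinearMap.congr_fun this y

/-- The linear extension of an additive `f` to `ℂ[G]` kills the boundaries `h - gh + g`, hence
factors through `H₁`. -/
theorem dualHom_surjective (G : Type) [Group G] : Function.Surjective (dualHom (G := G)) := by
  intro f
  let F : Module.Dual ℂ (G →₀ ℂ) := Finsupp.linearCombination ℂ fun g => f (Additive.ofMul g)
  have hF : F ∈ LinearMap.range (homologyClass G).dualMap := by
    rw [LinearMap.range_dualMap_eq_dualAnnihilator_ker, Submodule.mem_dualAnnihilator]
    intro x hx
    obtain ⟨y, rfl⟩ := (homologyClass_eq_zero_iff x).1 hx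
    have : F ∘ₗ (groupHomology.d₂₁ (coeff G)).hom = 0 := by
      refine Finsupp.lhom_ext fun p t => ?_
      refine (congrArg F (d₂₁_single_coeff p.1 p.2 t)).trans ?_
      simp only [F, map_add, map_sub, Finsupp.linearCombination_single, ofMul_mul, smul_add,
        LinearMap.zero_apply]
      ring
    exact LinearMap.congr_fun this y
  obtain ⟨ψ, hψ⟩ := hF
  refine ⟨ψ, AddMonoidHom.ext fun g => ?_⟩
  refine (LinearMap.congr_fun hψ (Finsupp.single g.toMul 1)).trans ?_
  simp [F]

theorem b₁_antidiagonalGroup (n : ℕ) : b₁ (AntidiagonalGroup n) = n := by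
  let e : Module.Dual ℂ (groupHomology.H1 (coeff (AntidiagonalGroup n))) ≃ₗ[ℂ]
      (Additive (AntidiagonalGroup n) →+ ℂ) :=
    LinearEquiv.ofBijective
      { toFun := dualHom
        map_add' := fun _ _ => rfl
        map_smul' := fun _ _ => rfl }
      ⟨dualHom_injective _, dualHom_surjective _⟩
  rw [b₁, ← Subspace.dual_finrank_eq, (e.trans ((toHom _).symm.trans (coord n))).finrank_eq]
  simp

end ComplexGroupCohomology

theorem mainTheorem8 (n : ℕ) (hn : 2 ≤ n) :
    ∃ (G : Type) (_ : Group G),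
      IsFinitelyPresentedCommutatorRelators G ∧
      ComplexGroupCohomology.b₁ G = n ∧
      (LinearMap.ker (ComplexGroupCohomology.cupProductMap G)).complexCodim = 2 * n - 3 ∧
      groupResonanceVariety G = {0} :=
  ⟨AntidiagonalGroup n, inferInstance,
    AntidiagonalGroup.isFinitelyPresentedCommutatorRelators n,
    ComplexGroupCohomology.b₁_antidiagonalGroup n,
    ComplexGroupCohomology.complexCodim_ker_cupProductMap n,
    ComplexGroupCohomology.groupResonanceVariety_antidiagonalGroup n⟩
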